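/- Let $d,n\ge 1$ be integers. Equip real projective space $\mathbb{R}P^d=S^d/\{\pm1\}$ with the quotient metric of the geodesic metric on the unit sphere $S^d\subset\mathbb{R}^{d+1}$, so that the distance of two points is the angle in $[0,\pi/2]$ between the corresponding lines through the origin of $\mathbb{R}^{d+1}$. Let $$p_{n+1}(\mathbb{R}P^d)=\sup\{\varepsilon>0 : \text{there are } x_1,\dots,x_{n+1}\in\mathbb{R}P^d \text{ with } d(x_i,x_j)\ge\varepsilon \text{ for all } i\ne j\}.$$ An oriented linear hyperplane in $\mathbb{R}^{d+1}$ is a hyperplane $H=\{y:\langle y,a\rangle=0\}$ through the origin together with the choice of a unit normal vector $a\in S^d$; its positive and negative halfspaces are $H^+=\{y:\langle y,a\rangle\ge 0\}$ and $H^-=\{y:\langle y,a\rangle\le 0\}$. The angle between two oriented linear hyperplanes is the angle in $[0,\pi]$ between their unit normal vectors. Theorem. Let $\mu_1,\dots,\mu_n$ be finite Borel measures on $S^d$ such that $\mu_i(L\cap S^d)=0$ for every $i$ and every linear hyperplane $L\subset\mathbb{R}^{d+1}$. Then there is a set $\mathcal{H}$ of oriented linear hyperplanes in $\mathbb{R}^{d+1}$,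 any two of which are at angle at most $\pi-p_{n+1}(\mathbb{R}P^d)$, such that for each $i\in\{1,\dots,n\}$ there are $H,K\in\mathcal{H}$ with $\mu_i(H^-\cap S^d)\ge\frac12\mu_i(S^d)$ and $\mu_i(K^+\cap S^d)\ge\frac12\mu_i(S^d)$. -/

import Mathlib

open MeasureTheory InnerProductGeometry

/-- The unit sphere `S^d` in `ℝ^{d+1}`, as a subspace of Euclidean space. Its Borel σ-algebra is the
one induced from `ℝ^{d+1}`. The geodesic distance of `x` and `y` is `angle x y`. -/
abbrev UnitSphere (d : ℕ) : Type :=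
  Metric.sphere (0 : EuclideanSpace ℝ (Fin (d + 1))) 1

/-- Real projective space `ℝP^d`: the lines through the origin of `ℝ^{d+1}`. -/
def RealProjectiveSpace (d : ℕ) : Type :=
  Projectivization ℝ (EuclideanSpace ℝ (Fin (d + 1)))

namespace RealProjectiveSpace

variable {d : ℕ}

/-- The quotient map `S^d → ℝP^d`, sending a unit vector to the line it spans. -/
noncomputable def proj (x : UnitSphere d) : RealProjectiveSpace d :=
  Projectivization.mk ℝ (x : EuclideanSpace ℝ (Fin (d + 1))) (ne_zero_of_mem_unit_sphere x)

theorem proj_surjective : Function.Surjective (proj (d := d)) := by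
  intro p
  induction p using Projectivization.ind with
  | h v hv =>
    have hn : ‖v‖ ≠ 0 := norm_ne_zero_iff.mpr hv
    refine ⟨⟨‖v‖⁻¹ • v, ?_⟩, ?_⟩
    · simp [norm_smul, hn]
    · exact (Projectivization.mk_eq_mk_iff' ℝ _ _ _ _).mpr ⟨‖v‖⁻¹, rfl⟩

/-- The fibres of the quotient map are the antipodal pairs. -/
theorem proj_eq_iff {x y : UnitSphere d} : proj x = proj y ↔ x = y ∨ x = -y := by
  have hx : ‖(x : EuclideanSpace ℝ (Fin (d + 1)))‖ = 1 := norm_eq_of_mem_sphere x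
  have hy : ‖(y : EuclideanSpace ℝ (Fin (d + 1)))‖ = 1 := norm_eq_of_mem_sphere y
  refine Iff.trans (Projectivization.mk_eq_mk_iff' ℝ _ _ _ _) ⟨?_, ?_⟩
  · rintro ⟨a, ha⟩
    have h1 : |a| = 1 := by
      have := congrArg norm ha
      simpa [norm_smul, hx, hy] using this
    rcases eq_or_eq_neg_of_abs_eq h1 with rfl | rfl
    · left; ext1; simpa using ha.symm
    · right; ext1; simpa using ha.symm
  · rintro (rfl | rfl)
    · exact ⟨1, by simp⟩
    · exact ⟨-1, by simp⟩

/-- The quotient metric on `ℝP^d`: the least geodesic distance in `S^d` between representatives,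
that is, the angle between the two lines. -/
noncomputable instance instDist : Dist (RealProjectiveSpace d) where
  dist p q := sInf {θ : ℝ | ∃ x y : UnitSphere d, proj x = p ∧ proj y = q ∧
    θ = angle (x : EuclideanSpace ℝ (Fin (d + 1))) (y : EuclideanSpace ℝ (Fin (d + 1)))}

theorem dist_proj (x y : UnitSphere d) : dist (proj x) (proj y) =
    min (angle (x : EuclideanSpace ℝ (Fin (d + 1))) y)
      (Real.pi - angle (x : EuclideanSpace ℝ (Fin (d + 1))) y) := by
  have key : {θ : ℝ | ∃ x' y' : UnitSphere d, proj x' = proj x ∧ proj y' = proj y ∧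
      θ = angle (x' : EuclideanSpace ℝ (Fin (d + 1))) (y' : EuclideanSpace ℝ (Fin (d + 1)))} =
      {angle (x : EuclideanSpace ℝ (Fin (d + 1))) y,
        Real.pi - angle (x : EuclideanSpace ℝ (Fin (d + 1))) y} := by
    ext θ
    simp only [Set.mem_ofPred_eq, Set.mem_insert_iff, Set.mem_singleton_iff, proj_eq_iff]
    constructor
    · rintro ⟨x', y', rfl | rfl, rfl | rfl, rfl⟩ <;>
        simp [angle_neg_left, angle_neg_right]
    · rintro (rfl | rfl)
      · exact ⟨x, y, .inl rfl, .inl rfl, rfl⟩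
      · exact ⟨x, -y, .inl rfl, .inr rfl, by simp [angle_neg_right]⟩
  change sInf _ = _
  rw [key, csInf_pair]

/-- The distance is attained by representatives, the first of which may be prescribed. -/
theorem exists_dist_eq_angle (x : UnitSphere d) (q : RealProjectiveSpace d) :
    ∃ y : UnitSphere d, proj y = q ∧ dist (proj x) q =
      angle (x : EuclideanSpace ℝ (Fin (d + 1))) (y : EuclideanSpace ℝ (Fin (d + 1))) := by
  obtain ⟨y, rfl⟩ := proj_surjective q
  rw [dist_proj]
  rcases min_choice (angle (x : EuclideanSpace ℝ (Fin (d + 1))) y)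
    (Real.pi - angle (x : EuclideanSpace ℝ (Fin (d + 1))) y) with h | h
  · exact ⟨y, rfl, h⟩
  · exact ⟨-y, proj_eq_iff.mpr (.inr rfl), by rw [h]; simp [angle_neg_right]⟩

noncomputable instance instMetricSpace : MetricSpace (RealProjectiveSpace d) where
  dist_self p := by
    obtain ⟨x, rfl⟩ := proj_surjective p
    rw [dist_proj, angle_self (ne_zero_of_mem_unit_sphere x)]
    simp [Real.pi_pos.le]
  dist_comm p q := by
    obtain ⟨x, rfl⟩ := proj_surjective p
    obtain ⟨y, rfl⟩ := proj_surjective q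
    rw [dist_proj, dist_proj, angle_comm]
  dist_triangle p q r := by
    obtain ⟨x, rfl⟩ := proj_surjective p
    obtain ⟨y, rfl, hy⟩ := exists_dist_eq_angle x q
    obtain ⟨z, rfl, hz⟩ := exists_dist_eq_angle y r
    rw [hy, hz, dist_proj]
    exact (min_le_left _ _).trans (angle_le_angle_add_angle _ _ _)
  eq_of_dist_eq_zero {p q} h := by
    obtain ⟨x, rfl⟩ := proj_surjective p
    obtain ⟨y, rfl, hy⟩ := exists_dist_eq_angle x q
    rw [h] at hy
    have hx1 : ‖(x : EuclideanSpace ℝ (Fin (d + 1)))‖ = 1 := norm_eq_of_mem_sphere x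
    have hy1 : ‖(y : EuclideanSpace ℝ (Fin (d + 1)))‖ = 1 := norm_eq_of_mem_sphere y
    have h1 : inner ℝ (x : EuclideanSpace ℝ (Fin (d + 1))) y = 1 := by
      have := inner_eq_mul_norm_of_angle_eq_zero hy.symm
      rwa [hx1, hy1, mul_one] at this
    have h2 := (inner_eq_one_iff_of_norm_eq_one hx1 hy1).mp h1
    exact congrArg proj (Subtype.ext h2)

end RealProjectiveSpace

/-- `p_n(X)`: the supremum of all `ε > 0` for which `X` contains `n` points with pairwise distances
at least `ε`. -/
noncomputable def packingDistance (n : ℕ) (X : Type*) [MetricSpace X] : ℝ :=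
  sSup {ε : ℝ | 0 < ε ∧ ∃ x : Fin n → X, ∀ i j, i ≠ j → ε ≤ dist (x i) (x j)}

/-- An oriented linear hyperplane in `ℝ^{d+1}`: the choice of the positive halfspace is the choice
of the unit normal vector that points into it. -/
structure OrientedHyperplane (d : ℕ) where
  normal : UnitSphere d

namespace OrientedHyperplane

variable {d : ℕ}

/-- The closed positive halfspace. -/
def posHalfspace (H : OrientedHyperplane d) : Set (EuclideanSpace ℝ (Fin (d + 1))) :=
  {y | 0 ≤ inner ℝ y (H.normal : EuclideanSpace ℝ (Fin (d + 1)))}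

/-- The closed negative halfspace. -/
def negHalfspace (H : OrientedHyperplane d) : Set (EuclideanSpace ℝ (Fin (d + 1))) :=
  {y | inner ℝ y (H.normal : EuclideanSpace ℝ (Fin (d + 1))) ≤ 0}

/-- The angle between two oriented hyperplanes, a number in `[0, π]`: the angle between their
positive unit normals. -/
noncomputable def angle (H K : OrientedHyperplane d) : ℝ :=
  InnerProductGeometry.angle (H.normal : EuclideanSpace ℝ (Fin (d + 1)))
    (K.normal : EuclideanSpace ℝ (Fin (d + 1)))

end OrientedHyperplane

/-! Take `n + 1` points of `ℝP^d` realising the packing distance, lift them to unit normals `x j`,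
and record how unevenly each hyperplane splits each measure. These imbalances form an `n × (n + 1)`
matrix, so some `c ≠ 0` satisfies `∑ j, c j * imbalance (μ i) ⟨x j⟩ = 0` for all `i`. Discard the
hyperplanes with `c j = 0` and reverse those with `c j < 0`. Reversal negates the imbalance, so the
weights become `|c j| > 0` (`abs_mul_imbalance_orient`). A vanishing sum with positive weights has a
nonnegative and a nonpositive term, which give `H` and `K` for each measure. The angle bound
survives every reorientation because the distance in `ℝP^d` depends only on lines
(`angle_le_pi_sub_dist`). -/

theorem exists_ne_zero_sum_mul_eq_zero {n : ℕ} (A : Fin n → Fin (n + 1) → ℝ) :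
    ∃ c : Fin (n + 1) → ℝ, c ≠ 0 ∧ ∀ i, ∑ j, c j * A i j = 0 := by
  have h : LinearMap.ker (Matrix.mulVecLin (Matrix.of A)) ≠ ⊥ :=
    LinearMap.ker_ne_bot_of_finrank_lt (by simp)
  obtain ⟨c, hc, hc0⟩ := Submodule.exists_mem_ne_zero_of_ne_bot h
  refine ⟨c, hc0, fun i => ?_⟩
  have := congrFun (LinearMap.mem_ker.mp hc) i
  simpa [Matrix.mulVec, dotProduct, mul_comm] using this

/-- Otherwise every term with `c j ≠ 0` is negative and the others vanish; as `c ≠ 0`, the sum would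
be negative. -/
theorem exists_ne_zero_mul_nonneg_of_sum_eq_zero {ι : Type*} [Fintype ι] {c v : ι → ℝ}
    (hc : c ≠ 0) (h : ∑ j, c j * v j = 0) : ∃ j, c j ≠ 0 ∧ 0 ≤ c j * v j := by
  by_contra! hneg
  obtain ⟨k, hk⟩ := Function.ne_iff.mp hc
  have : ∑ j, c j * v j < 0 := by
    refine Finset.sum_neg' (fun j _ => ?_) ⟨k, Finset.mem_univ k, hneg k hk⟩
    by_cases hj : c j = 0
    · simp [hj]
    · exact (hneg j hj).le
  exact this.ne h

namespace RealProjectiveSpace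

/-- The supremum defining the packing distance of `ℝP^d` is a lower bound for the pairwise
distances of some configuration. -/
theorem exists_packingDistance_le (d : ℕ) {m : ℕ} (hm : 2 ≤ m) :
    ∃ x : Fin m → UnitSphere d, ∀ i j, i ≠ j →
      packingDistance m (RealProjectiveSpace d) ≤ dist (proj (x i)) (proj (x j)) := by
  have hne : (Finset.univ : Finset (Fin m)).offDiag.Nonempty :=
    ⟨(⟨0, by omega⟩, ⟨1, by omega⟩), by simp⟩
  -- The least pairwise distance, as a function of lifts to the compact space `(S^d)^m`: it is
  -- continuous, so it attains its maximum.
  let g : (Fin m → UnitSphere d) → ℝ := fun x =>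
    (Finset.univ : Finset (Fin m)).offDiag.inf' hne fun p => dist (proj (x p.1)) (proj (x p.2))
  have hg : Continuous g := by
    refine Continuous.finset_inf'_apply hne fun p _ => ?_
    simp only [dist_proj]
    have hangle : Continuous fun x : Fin m → UnitSphere d =>
        angle (x p.1 : EuclideanSpace ℝ (Fin (d + 1))) (x p.2) := by
      rw [continuous_iff_continuousAt]
      intro x
      exact ContinuousAt.comp (f := fun x : Fin m → UnitSphere d =>
          ((x p.1 : EuclideanSpace ℝ (Fin (d + 1))), (x p.2 : EuclideanSpace ℝ (Fin (d + 1)))))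
        (continuousAt_angle (ne_zero_of_mem_unit_sphere (x p.1))
          (ne_zero_of_mem_unit_sphere (x p.2))) (by fun_prop)
    exact hangle.min (continuous_const.sub hangle)
  have : Nonempty (UnitSphere d) := (NormedSpace.sphere_nonempty.mpr zero_le_one).to_subtype
  obtain ⟨x, -, hx⟩ := isCompact_univ.exists_isMaxOn Set.univ_nonempty hg.continuousOn
  have hle : packingDistance m (RealProjectiveSpace d) ≤ g x := by
    -- The bound `0 ≤ g x` covers an empty set of admissible `ε`, whose `sSup` is `0`.
    refine Real.sSup_le ?_ (Finset.le_inf' _ _ fun _ _ => dist_nonneg)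
    rintro ε ⟨-, y, hy⟩
    choose z hz using fun i => proj_surjective (y i)
    refine le_trans (Finset.le_inf' _ _ fun p hp => ?_) (hx (Set.mem_univ z))
    rw [hz, hz]
    exact hy _ _ (Finset.mem_offDiag.mp hp).2.2
  exact ⟨x, fun i j hij => hle.trans
    (Finset.inf'_le (fun p : Fin m × Fin m => dist (proj (x p.1)) (proj (x p.2)))
      (b := (i, j)) (by simpa using hij))⟩

end RealProjectiveSpace

namespace OrientedHyperplane

variable {d : ℕ}

/-- The same hyperplane with the opposite orientation. -/
noncomputable def reverse (H : OrientedHyperplane d) : OrientedHyperplane d := ⟨-H.normal⟩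

theorem posHalfspace_reverse (H : OrientedHyperplane d) :
    H.reverse.posHalfspace = H.negHalfspace := by
  ext y; simp [reverse, posHalfspace, negHalfspace]

theorem negHalfspace_reverse (H : OrientedHyperplane d) :
    H.reverse.negHalfspace = H.posHalfspace := by
  ext y; simp [reverse, posHalfspace, negHalfspace]

theorem angle_le_pi_sub_dist (H K : OrientedHyperplane d) :
    H.angle K ≤ Real.pi -
      dist (RealProjectiveSpace.proj H.normal) (RealProjectiveSpace.proj K.normal) := by
  rw [RealProjectiveSpace.dist_proj, le_sub_comm]
  exact min_le_right _ _

/-- The measure of the closed negative halfspace minus that of the closed positive one. -/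
noncomputable def imbalance (μ : Measure (UnitSphere d)) (H : OrientedHyperplane d) : ℝ :=
  μ.real {x | (x : EuclideanSpace ℝ (Fin (d + 1))) ∈ H.negHalfspace} -
    μ.real {x | (x : EuclideanSpace ℝ (Fin (d + 1))) ∈ H.posHalfspace}

theorem imbalance_reverse (μ : Measure (UnitSphere d)) (H : OrientedHyperplane d) :
    imbalance μ H.reverse = -imbalance μ H := by
  simp [imbalance, posHalfspace_reverse, negHalfspace_reverse]

/-- The two closed halfspaces cover the sphere, so the one of larger measure carries at least half.
-/
theorem half_le_negHalfspace (μ : Measure (UnitSphere d)) [IsFiniteMeasure μ]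
    {H : OrientedHyperplane d} (h : 0 ≤ imbalance μ H) :
    μ Set.univ / 2 ≤ μ {x | (x : EuclideanSpace ℝ (Fin (d + 1))) ∈ H.negHalfspace} := by
  have hle : μ {x | (x : EuclideanSpace ℝ (Fin (d + 1))) ∈ H.posHalfspace} ≤
      μ {x | (x : EuclideanSpace ℝ (Fin (d + 1))) ∈ H.negHalfspace} :=
    (ENNReal.toReal_le_toReal (measure_ne_top _ _) (measure_ne_top _ _)).mp (sub_nonneg.mp h)
  have hcover : (Set.univ : Set (UnitSphere d)) ⊆
      {x | (x : EuclideanSpace ℝ (Fin (d + 1))) ∈ H.negHalfspace} ∪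
        {x | (x : EuclideanSpace ℝ (Fin (d + 1))) ∈ H.posHalfspace} :=
    fun x _ => le_total (inner ℝ (x : EuclideanSpace ℝ (Fin (d + 1)))
      (H.normal : EuclideanSpace ℝ (Fin (d + 1)))) 0
  refine ENNReal.div_le_of_le_mul ?_
  calc μ Set.univ ≤ _ := (measure_mono hcover).trans (measure_union_le _ _)
    _ ≤ _ := by rw [mul_two]; gcongr

theorem half_le_posHalfspace (μ : Measure (UnitSphere d)) [IsFiniteMeasure μ]
    {H : OrientedHyperplane d} (h : imbalance μ H ≤ 0) :
    μ Set.univ / 2 ≤ μ {x | (x : EuclideanSpace ℝ (Fin (d + 1))) ∈ H.posHalfspace} := by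
  rw [← negHalfspace_reverse]
  exact half_le_negHalfspace μ (by rw [imbalance_reverse]; linarith)

/-- The hyperplane `H`, reversed if `c` is negative. -/
noncomputable def orient (c : ℝ) (H : OrientedHyperplane d) : OrientedHyperplane d :=
  if 0 ≤ c then H else H.reverse

theorem proj_normal_orient (c : ℝ) (H : OrientedHyperplane d) :
    RealProjectiveSpace.proj (orient c H).normal = RealProjectiveSpace.proj H.normal := by
  rw [RealProjectiveSpace.proj_eq_iff, orient]
  split_ifs
  · exact .inl rfl
  · exact .inr rfl

theorem abs_mul_imbalance_orient (μ : Measure (UnitSphere d)) (c : ℝ)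
    (H : OrientedHyperplane d) : |c| * imbalance μ (orient c H) = c * imbalance μ H := by
  rw [orient]
  split_ifs with h
  · rw [abs_of_nonneg h]
  · rw [abs_of_neg (not_le.mp h), imbalance_reverse, neg_mul_neg]

end OrientedHyperplane

open OrientedHyperplane in
theorem mainTheorem8 (d n : ℕ) (hd : 1 ≤ d) (hn : 1 ≤ n)
    (μ : Fin n → Measure (UnitSphere d)) (hfin : ∀ i, IsFiniteMeasure (μ i))
    (hnull : ∀ i, ∀ L : Submodule ℝ (EuclideanSpace ℝ (Fin (d + 1))), Module.finrank ℝ L = d →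
      μ i {x | (x : EuclideanSpace ℝ (Fin (d + 1))) ∈ L} = 0) :
    ∃ 𝓗 : Set (OrientedHyperplane d),
      (∀ H ∈ 𝓗, ∀ K ∈ 𝓗,
        H.angle K ≤ Real.pi - packingDistance (n + 1) (RealProjectiveSpace d)) ∧
      ∀ i,
        (∃ H ∈ 𝓗, μ i Set.univ / 2 ≤
          μ i {x | (x : EuclideanSpace ℝ (Fin (d + 1))) ∈ H.negHalfspace}) ∧
        (∃ H ∈ 𝓗, μ i Set.univ / 2 ≤
          μ i {x | (x : EuclideanSpace ℝ (Fin (d + 1))) ∈ H.posHalfspace}) := by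
  obtain ⟨x, hx⟩ := RealProjectiveSpace.exists_packingDistance_le d (m := n + 1) (by omega)
  obtain ⟨c, hc, hsum⟩ := exists_ne_zero_sum_mul_eq_zero fun i j => imbalance (μ i) ⟨x j⟩
  -- Requiring `c j ≠ 0` fixes one orientation per index, and the sign of an imbalance can be read
  -- off after cancelling `|c j|`.
  refine ⟨{H | ∃ j, c j ≠ 0 ∧ H = orient (c j) ⟨x j⟩}, ?_, fun i => ⟨?_, ?_⟩⟩
  · rintro _ ⟨j, -, rfl⟩ _ ⟨k, -, rfl⟩
    by_cases hjk : j = k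
    · subst hjk
      -- The angle is `0` here, so only this bound is needed; it comes from two distinct indices,
      -- which exist since `1 ≤ n`.
      have hle : packingDistance (n + 1) (RealProjectiveSpace d) ≤ Real.pi := by
        refine (hx 0 (Fin.last n) (Fin.ne_of_val_ne (by simp; omega))).trans ?_
        rw [RealProjectiveSpace.dist_proj]
        exact (min_le_left _ _).trans (angle_le_pi _ _)
      rw [OrientedHyperplane.angle, angle_self (ne_zero_of_mem_unit_sphere _)]
      exact sub_nonneg.mpr hle
    · refine (angle_le_pi_sub_dist _ _).trans ?_
      rw [proj_normal_orient, proj_normal_orient]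
      exact sub_le_sub_left (hx j k hjk) _
  · obtain ⟨j, hj, h⟩ := exists_ne_zero_mul_nonneg_of_sum_eq_zero hc (hsum i)
    refine ⟨_, ⟨j, hj, rfl⟩, half_le_negHalfspace (μ i) ?_⟩
    rw [← abs_mul_imbalance_orient] at h
    exact nonneg_of_mul_nonneg_right h (abs_pos.mpr hj)
  -- The same sign argument for the negated imbalances, with the same `c`.
  · obtain ⟨j, hj, h⟩ := exists_ne_zero_mul_nonneg_of_sum_eq_zero
      (v := fun j => -imbalance (μ i) ⟨x j⟩) hc (by simpa using hsum i)
    refine ⟨_, ⟨j, hj, rfl⟩, half_le_posHalfspace (μ i) ?_⟩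
    rw [mul_neg, ← abs_mul_imbalance_orient, ← mul_neg] at h
    exact neg_nonneg.mp (nonneg_of_mul_nonneg_right h (abs_pos.mpr hj))
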